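/- Let $\mathcal{I}$ (customer classes) and $\mathcal{J}$ (server pools) be finite sets, and let $\mathcal{G}$ be a bipartite graph on $\mathcal{I}\cup\mathcal{J}$ that is a tree; write $i\sim j$ if class $i\in\mathcal{I}$ and pool $j\in\mathcal{J}$ are joined by an edge, and $\mathcal{J}(i)=\{j: j\sim i\}$. Let $\lambda_i>0$, $\nu_j>0$, $\mu_{ij}>0$ ($i\sim j$) and $\hat\lambda_i,\hat\mu_{ij},\hat\nu_j\in\mathbb{R}$ be the limiting first- and second-order parameters (arrival rates, pool sizes, service rates) of a multiclass multi-pool network in the Halfin–Whitt regime. Assume complete resource pooling: the linear program of minimizing $\max_{j}\sum_i\xi_{ij}$ over $\xi\ge 0$ with $\xi_{ij}=0$ for $i\nsim j$ and $\sum_j\mu_{ij}\nu_j\xi_{ij}=\lambda_i$ for all $i$ has a unique solution $\xi^*$, and $\sum_i\xi^*_{ij}=1$ for all $j$, $\xi^*_{ij}>0$ for all $i\sim j$. Let $h_i=\hat\lambda_i-\sum_{j\in\mathcal{J}(i)}(\mu_{ij}\xi^*_{ij}\hat\nu_j+\hat\mu_{ij}\xi^*_{ij}\nu_j)$. For $\alpha\in\mathbb{R}^{\mathcal{I}}$,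 $\beta\in\mathbb{R}^{\mathcal{J}}$ with $\sum_i\alpha_i=\sum_j\beta_j$ let $\Psi(\alpha,\beta)$ be the unique matrix with $\Psi_{ij}=0$ for $i\nsim j$, row sums $\sum_j\Psi_{ij}=\alpha_i$ and column sums $\sum_i\Psi_{ij}=\beta_j$. Let $e$ denote the vector of ones and $s^{\pm}$ the positive and negative parts of $s\in\mathbb R$. The drift of the limiting controlled diffusion is $$b_i(x,u)=h_i-\sum_{j\in\mathcal{J}(i)}\mu_{ij}\Psi_{ij}\bigl(x-\langle e,x\rangle^+u^c,\,-\langle e,x\rangle^-u^s\bigr),$$ for $x\in\mathbb{R}^{\mathcal{I}}$ and $u=(u^c,u^s)$ a pair of probability vectors on $\mathcal{I}$ and $\mathcal{J}$. Fix any pool $\hat\jmath\in\mathcal{J}$. Then there is exactly one pair of real matrices $B_1$ (of size $\mathcal{I}\times\mathcal{I}$) and $B_2$ (of size $\mathcal{I}\times\mathcal{J}$) such that the column of $B_2$ at $\hat\jmath$ is zero and $$b(x,u)=h-B_1\bigl(x-\langle e,x\rangle^+u^c\bigr)+\langle e,x\rangle^-B_2u^s\qquad\text{for all }x,u.$$ The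 matrix $B_1$ is invertible, and $$\mathfrak{d}(i,\ell)=\frac{(e^{\mathsf T}B_1^{-1})_\ell}{(e^{\mathsf T}B_1^{-1})_i}\qquad\text{for all } i,\ell\in\mathcal{I},$$ where the gain is $\mathfrak{d}(i,\ell)=\prod_{k=1}^{m-1}\frac{\mu_{i_kj_k}}{\mu_{i_{k+1}j_k}}$ over the unique path $(i_1,j_1,i_2,\dots,j_{m-1},i_m)$ in $\mathcal{G}$ from $i=i_1$ to $\ell=i_m$ (so $\mathfrak{d}(i,i)=1$). Moreover, $(e^{\mathsf T}B_1^{-1})_i>0$ for all $i\in\mathcal{I}$. -/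

import Mathlib

open scoped Matrix

noncomputable section

/-- The limiting parameters of a multiclass multi-pool network with set of customer classes `ι`
and set of server pools `κ`. -/
structure NetworkData (ι κ : Type*) where
  /-- `serves i j` : pool `j` can serve class `i`, that is, `i ∼ j`. -/
  serves : ι → κ → Prop
  /-- limiting arrival rates `λ i` -/
  lam : ι → ℝ
  /-- limiting service rates `μ i j` (meaningful for `i ∼ j`) -/
  mu : ι → κ → ℝ
  /-- limiting relative pool sizes `ν j` -/
  nu : κ → ℝ
  /-- second order (square root) term of the arrival rates -/
  lamHat : ι → ℝ
  /-- second order term of the service rates -/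
  muHat : ι → κ → ℝ
  /-- second order term of the pool sizes -/
  nuHat : κ → ℝ

namespace NetworkData

variable {ι κ : Type*} (D : NetworkData ι κ)

/-- Adjacency in the bipartite graph of classes and pools. -/
def Adj : ι ⊕ κ → ι ⊕ κ → Prop
  | Sum.inl i, Sum.inr j => D.serves i j
  | Sum.inr j, Sum.inl i => D.serves i j
  | _, _ => False

/-- The bipartite graph on classes and pools, with an edge between `i` and `j` iff `i ∼ j`. -/
def graph : SimpleGraph (ι ⊕ κ) where
  Adj := D.Adj
  symm := ⟨by
    rintro (i | j) (i' | j') h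
    · exact h
    · exact h
    · exact h
    · exact h⟩
  loopless := ⟨by
    rintro (i | j) h
    · exact h
    · exact h⟩

open Classical in
/-- The set of pools that can serve class `i`. -/
def pools [Fintype κ] (i : ι) : Finset κ := {j | D.serves i j}

/-- Feasibility for the static allocation linear program: `ξ ≥ 0`, `ξ i j = 0` for `i ≁ j`, and
`∑ j, μ i j ν j ξ i j = λ i` for all classes `i`. -/
def IsFeasible [Fintype κ] (ξ : ι → κ → ℝ) : Prop :=
  (∀ i j, 0 ≤ ξ i j) ∧ (∀ i j, ¬ D.serves i j → ξ i j = 0) ∧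
    ∀ i, ∑ j, D.mu i j * D.nu j * ξ i j = D.lam i

/-- `ξ` minimizes `max_j ∑_i ξ i j` over the feasible allocations. -/
def IsOptimal [Fintype ι] [Fintype κ] (ξ : ι → κ → ℝ) : Prop :=
  D.IsFeasible ξ ∧ ∀ ξ', D.IsFeasible ξ' → (⨆ j, ∑ i, ξ i j) ≤ ⨆ j, ∑ i, ξ' i j

/-- The factor of one step of a walk: `μ i j` for a step from class `i` to pool `j`,
and `(μ i j)⁻¹` for a step from pool `j` to class `i`. -/
def stepGain : ι ⊕ κ → ι ⊕ κ → ℝ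
  | Sum.inl i, Sum.inr j => D.mu i j
  | Sum.inr j, Sum.inl i => (D.mu i j)⁻¹
  | _, _ => 1

/-- The product of the factors of the steps of a walk. On a walk `i₁, j₁, i₂, j₂, …, i_m` it is
`∏_{k < m} μ (i_k) (j_k) / μ (i_{k+1}) (j_k)`. -/
def walkGain : {u v : ι ⊕ κ} → D.graph.Walk u v → ℝ
  | _, _, SimpleGraph.Walk.nil => 1
  | u, _, SimpleGraph.Walk.cons (v := w) _ p => D.stepGain u w * walkGain p

/-- `z` is a flow on the edges of the graph with class marginals `α` and pool marginals `β`. -/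
def IsFlow [Fintype ι] [Fintype κ] (α : ι → ℝ) (β : κ → ℝ) (z : ι → κ → ℝ) : Prop :=
  (∀ i j, ¬ D.serves i j → z i j = 0) ∧ (∀ i, ∑ j, z i j = α i) ∧ ∀ j, ∑ i, z i j = β j

open Classical in
/-- The map `Ψ`: the solution `z` of `∑ j, z i j = α i`, `∑ i, z i j = β j`, `z i j = 0` for
`i ≁ j`. When the graph is a tree, there is exactly one solution for each pair `(α, β)` whose
entries have equal sums. -/
def Psi [Fintype ι] [Fintype κ] (α : ι → ℝ) (β : κ → ℝ) : ι → κ → ℝ :=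
  if h : ∃ z, D.IsFlow α β z then h.choose else 0

end NetworkData

/-- A multiclass multi-pool network in the Halfin-Whitt regime, whose graph is a tree, under the
complete resource pooling condition. -/
structure ParallelNetwork (ι κ : Type*) [Fintype ι] [Fintype κ] extends NetworkData ι κ where
  lam_pos : ∀ i, 0 < lam i
  nu_pos : ∀ j, 0 < nu j
  mu_pos : ∀ i j, serves i j → 0 < mu i j
  /-- the graph is a tree -/
  isTree : toNetworkData.graph.IsTree
  /-- the solution `ξ*` of the static allocation linear program -/
  xiStar : ι → κ → ℝ
  /-- the linear program has `ξ*` as its unique solution -/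
  isOptimal_iff : ∀ ξ, toNetworkData.IsOptimal ξ ↔ ξ = xiStar
  xiStar_sum : ∀ j, ∑ i, xiStar i j = 1
  xiStar_pos : ∀ i j, serves i j → 0 < xiStar i j

namespace ParallelNetwork

variable {ι κ : Type*} [Fintype ι] [Fintype κ] (N : ParallelNetwork ι κ)

/-- The gain `𝔡(i, l)` between two classes: the product of
`μ (i_k) (j_k) / μ (i_{k+1}) (j_k)` over the unique path `i = i₁, j₁, i₂, …, i_m = l`
(in particular `𝔡(i, i) = 1`). -/
def gain (i l : ι) : ℝ :=
  N.walkGain (N.isTree.existsUnique_path (Sum.inl i) (Sum.inl l)).choose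

/-- `z* i j = ξ* i j ν j`. -/
def zStar (i : ι) (j : κ) : ℝ := N.xiStar i j * N.nu j

/-- The constant term of the drift. -/
def h (i : ι) : ℝ :=
  N.lamHat i - ∑ j ∈ N.pools i, (N.mu i j * N.xiStar i j * N.nuHat j + N.muHat i j * N.zStar i j)

/-- The drift `b(x, u)`, `u = (uc, us)`, of the limiting controlled diffusion:
`b_i(x, u) = h_i - ∑_{j ∼ i} μ i j Ψ_{ij}(x - ⟨e, x⟩⁺ uc, - ⟨e, x⟩⁻ us)`. -/
def drift (x : ι → ℝ) (uc : ι → ℝ) (us : κ → ℝ) (i : ι) : ℝ :=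
  N.h i - ∑ j ∈ N.pools i,
    N.mu i j * N.Psi (x - max (∑ k, x k) 0 • uc) (-(max (-∑ k, x k) 0 • us)) i j

/-- `B₁` and `B₂` are matrices of the drift of the limiting diffusion relative to the pool `j₀`:
`b(x, u) = h - B₁ (x - ⟨e, x⟩⁺ uc) + ⟨e, x⟩⁻ B₂ us` for all `x` and all pairs `u = (uc, us)` of
probability vectors, where the column of `B₂` at `j₀` is zero. -/
def IsDriftMatrices (j₀ : κ) (B₁ : Matrix ι ι ℝ) (B₂ : Matrix ι κ ℝ) : Prop :=
  (∀ x : ι → ℝ, ∀ uc ∈ stdSimplex ℝ ι, ∀ us ∈ stdSimplex ℝ κ,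
    N.drift x uc us =
      N.h - B₁ *ᵥ (x - max (∑ k, x k) 0 • uc) + max (-∑ k, x k) 0 • (B₂ *ᵥ us)) ∧
  ∀ i, B₂ i j₀ = 0

end ParallelNetwork

end

/-!
On a tree, an edge flow is determined by its marginals (each edge is a bridge, so testing a flow
with zero marginals against the indicator of one side of the cut isolates a single edge), and every
balanced pair of marginals is attained (a functional vanishing on all edges is constant along the
graph, hence vanishes on balanced pairs). So `Ψ` is linear on balanced pairs, and letting the pool
`j₀` absorb the imbalance extends it linearly to all pairs `(α, β)`. The drift matrices are the
service rates of this extension.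

Let `π v` be the gain of the path from `j₀` to `v`. As `π i * μ i j = π j` on edges, multiplying the
service rates `μ i j * z i j` of a flow by `π i` gives another flow, whose pool marginals are those
of `z` times `π j`. Apply this to the flow with marginals `(α, ⟨e, α⟩ e_{j₀})`: equality of the two
totals says `π B₁ = eᵀ`, and if `B₁ α = 0` then all marginals of the reweighted flow vanish, so
`α = 0`. Hence `eᵀ B₁⁻¹ = π`, and the gain formula is multiplicativity of path gains.
-/

lemma apply_eq_sum_smul_single {R M γ : Type*} [Semiring R] [AddCommMonoid M] [Module R M]
    [Fintype γ] [DecidableEq γ] (f : (γ → R) →ₗ[R] M) (x : γ → R) :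
    f x = ∑ c, x c • f (Pi.single c 1) := by
  simp only [← map_smul, ← map_sum, ← Pi.single_smul, smul_eq_mul, mul_one,
    Finset.univ_sum_single]

section Graph

variable {V : Type*} {G : SimpleGraph V}

lemma apply_eq_of_forall_adj {X : Type*} (hG : G.Preconnected) {f : V → X}
    (hf : ∀ u v, G.Adj u v → f u = f v) (u v : V) : f u = f v := by
  obtain ⟨p⟩ := hG u v
  induction p with
  | nil => rfl
  | cons huw _ ih => exact (hf _ _ huw).trans ih

lemma exists_cut_of_isBridge {u v : V} (huv : G.IsBridge s(u, v)) :
    ∃ S : Set V, u ∈ S ∧ v ∉ S ∧ ∀ a b, G.Adj a b → s(a, b) ≠ s(u, v) → (a ∈ S ↔ b ∈ S) := by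
  refine ⟨{w | (G.deleteEdges {s(u, v)}).Reachable u w}, .refl u,
    SimpleGraph.isBridge_iff.1 huv, fun a b hab hne => ?_⟩
  have hab' : (G.deleteEdges {s(u, v)}).Adj a b := SimpleGraph.deleteEdges_adj.2 ⟨hab, hne⟩
  exact ⟨fun h => h.trans hab'.reachable, fun h => h.trans hab'.symm.reachable⟩

end Graph

namespace NetworkData

variable {ι κ : Type*} {D : NetworkData ι κ}

section Flow

variable [Fintype ι] [Fintype κ] {α α' : ι → ℝ} {β β' : κ → ℝ} {z z' : ι → κ → ℝ}

namespace IsFlow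

lemma zero : D.IsFlow 0 0 0 := by simp [IsFlow]

lemma add (hz : D.IsFlow α β z) (hz' : D.IsFlow α' β' z') :
    D.IsFlow (α + α') (β + β') (z + z') := by
  refine ⟨fun i j hij => ?_, fun i => ?_, fun j => ?_⟩
  · simp [hz.1 i j hij, hz'.1 i j hij]
  · simp [Finset.sum_add_distrib, hz.2.1, hz'.2.1]
  · simp [Finset.sum_add_distrib, hz.2.2, hz'.2.2]

lemma smul (c : ℝ) (hz : D.IsFlow α β z) : D.IsFlow (c • α) (c • β) (c • z) := by
  refine ⟨fun i j hij => ?_, fun i => ?_, fun j => ?_⟩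
  · simp [hz.1 i j hij]
  · simp [← Finset.mul_sum, hz.2.1]
  · simp [← Finset.mul_sum, hz.2.2]

lemma single [DecidableEq ι] [DecidableEq κ] {i : ι} {j : κ} (hij : D.serves i j) :
    D.IsFlow (Pi.single i 1) (Pi.single j 1) (Pi.single i (Pi.single j 1)) := by
  refine ⟨fun a b hab => ?_, fun a => ?_, fun b => ?_⟩
  · by_contra hne
    obtain rfl : a = i := by by_contra h; simp [h] at hne
    obtain rfl : b = j := by by_contra h; simp [h] at hne
    exact hab hij
  · rcases eq_or_ne a i with rfl | h <;> simp [*]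
  · simp [← Finset.sum_apply, Finset.sum_pi_single']

lemma sum_eq (hz : D.IsFlow α β z) : ∑ i, α i = ∑ j, β j := by
  simp only [← hz.2.1, ← hz.2.2]
  exact Finset.sum_comm

lemma sum_sum_sub_mul (hz : D.IsFlow α β z) (f : ι ⊕ κ → ℝ) :
    ∑ i, ∑ j, (f (.inl i) - f (.inr j)) * z i j =
      ∑ i, f (.inl i) * α i - ∑ j, f (.inr j) * β j := by
  simp only [sub_mul, Finset.sum_sub_distrib, ← hz.2.1, ← hz.2.2, Finset.mul_sum]
  rw [Finset.sum_comm (f := fun i j => f (.inr j) * z i j)]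

lemma eq_zero (hD : D.graph.IsAcyclic) (hz : D.IsFlow 0 0 z) : z = 0 := by
  classical
  ext i j
  by_cases hij : D.serves i j
  swap
  · exact hz.1 i j hij
  have hbridge : D.graph.IsBridge s(.inl i, .inr j) :=
    SimpleGraph.isAcyclic_iff_forall_adj_isBridge.1 hD hij
  obtain ⟨S, hi, hj, hS⟩ := exists_cut_of_isBridge hbridge
  let χ : ι ⊕ κ → ℝ := S.indicator 1
  have hother : ∀ a b, ¬ (a = i ∧ b = j) → (χ (.inl a) - χ (.inr b)) * z a b = 0 := by
    intro a b hab
    by_cases hs : D.serves a b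
    · have hχ : χ (.inl a) = χ (.inr b) :=
        Set.indicator_eq_indicator (hS _ _ hs (by simpa using hab)) rfl
      rw [hχ, sub_self, zero_mul]
    · rw [hz.1 a b hs, mul_zero]
  calc z i j = (χ (.inl i) - χ (.inr j)) * z i j := by simp [χ, hi, hj]
    _ = ∑ a, ∑ b, (χ (.inl a) - χ (.inr b)) * z a b := by
      rw [Fintype.sum_eq_single i fun a ha =>
          Finset.sum_eq_zero fun b _ => hother a b fun h => ha h.1,
        Fintype.sum_eq_single j fun b hb => hother i b fun h => hb h.2]
    _ = 0 := by rw [hz.sum_sum_sub_mul]; simp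

lemma unique (hD : D.graph.IsAcyclic) (hz : D.IsFlow α β z) (hz' : D.IsFlow α β z') :
    z = z' := by
  have hsub : D.IsFlow 0 0 (z + (-1 : ℝ) • z') := by simpa using hz.add (hz'.smul (-1))
  simpa [← sub_eq_add_neg, sub_eq_zero] using hsub.eq_zero hD

lemma Psi_eq (hD : D.graph.IsAcyclic) (hz : D.IsFlow α β z) : D.Psi α β = z := by
  have hex : ∃ z, D.IsFlow α β z := ⟨z, hz⟩
  rw [Psi, dif_pos hex]
  exact hex.choose_spec.unique hD hz

end IsFlow

/-- The pairs of marginals of flows, as a linear subspace. -/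
def flowMarginals (D : NetworkData ι κ) : Submodule ℝ ((ι → ℝ) × (κ → ℝ)) where
  carrier := {a | ∃ z, D.IsFlow a.1 a.2 z}
  zero_mem' := ⟨0, .zero⟩
  add_mem' := fun ⟨_, hz⟩ ⟨_, hz'⟩ => ⟨_, hz.add hz'⟩
  smul_mem' := fun c _ ⟨_, hz⟩ => ⟨_, hz.smul c⟩

lemma mem_flowMarginals_of_sum_eq (hD : D.graph.Connected) (h : ∑ i, α i = ∑ j, β j) :
    (α, β) ∈ D.flowMarginals := by
  classical
  by_contra hmem
  obtain ⟨f, hf, hker⟩ := Submodule.exists_le_ker_of_notMem hmem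
  let φ : ι ⊕ κ → ℝ := Sum.elim (fun i => f (Pi.single i 1, 0)) (fun j => -f (0, Pi.single j 1))
  have hedge : ∀ i j, D.serves i j → φ (.inl i) = φ (.inr j) := fun i j hij => by
    have h0 : f (Pi.single i 1, Pi.single j 1) = 0 := hker ⟨_, .single hij⟩
    rw [← Prod.fst_add_snd (Pi.single i 1, Pi.single j 1), map_add] at h0
    exact eq_neg_of_add_eq_zero_left h0
  have hadj : ∀ u v, D.graph.Adj u v → φ u = φ v := by
    rintro (i | j) (i' | j') huv
    · exact huv.elim
    · exact hedge i j' huv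
    · exact (hedge i' j huv).symm
    · exact huv.elim
  obtain ⟨v₀⟩ := hD.nonempty
  have hφ : ∀ v, φ v = φ v₀ := (apply_eq_of_forall_adj hD.preconnected hadj · v₀)
  have hexpand : f (α, β) = ∑ i, α i * φ (.inl i) - ∑ j, β j * φ (.inr j) := by
    have hα := apply_eq_sum_smul_single (f ∘ₗ .inl ℝ (ι → ℝ) (κ → ℝ)) α
    have hβ := apply_eq_sum_smul_single (f ∘ₗ .inr ℝ (ι → ℝ) (κ → ℝ)) β
    simp only [LinearMap.comp_apply, LinearMap.inl_apply, LinearMap.inr_apply] at hα hβ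
    rw [← Prod.fst_add_snd (α, β), map_add, hα, hβ]
    simp [φ]
  apply hf
  simp only [hexpand, hφ, ← Finset.sum_mul, h, sub_self]

lemma isFlow_Psi (hD : D.graph.Connected) (h : ∑ i, α i = ∑ j, β j) :
    D.IsFlow α β (D.Psi α β) := by
  have hex : ∃ z, D.IsFlow α β z := mem_flowMarginals_of_sum_eq hD h
  rw [Psi, dif_pos hex]
  exact hex.choose_spec

end Flow

section ClosedFlow

variable [Fintype ι] [Fintype κ] [DecidableEq κ]

/-- The pool vector `β + (∑ i, α i - ∑ j, β j) e_{j₀}`: the pool `j₀` absorbs the imbalance between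
`α` and `β`. -/
def absorb (j₀ : κ) : (ι → ℝ) × (κ → ℝ) →ₗ[ℝ] (κ → ℝ) where
  toFun a := a.2 + Pi.single j₀ (∑ i, a.1 i - ∑ j, a.2 j)
  map_add' a b := by
    simp only [Prod.fst_add, Prod.snd_add, Pi.add_apply, Finset.sum_add_distrib,
      add_sub_add_comm, Pi.single_add]
    abel
  map_smul' c a := by
    simp [← Finset.mul_sum, ← mul_sub, ← Pi.single_smul]

lemma absorb_apply (j₀ : κ) (α : ι → ℝ) (β : κ → ℝ) :
    absorb j₀ (α, β) = β + Pi.single j₀ (∑ i, α i - ∑ j, β j) := rfl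

lemma sum_eq_sum_absorb (j₀ : κ) (a : (ι → ℝ) × (κ → ℝ)) :
    ∑ i, a.1 i = ∑ j, absorb j₀ a j := by
  simp [absorb, Finset.sum_add_distrib]

/-- `Ψ` as a linear map on all pairs of marginals: unbalanced pairs are first balanced at the
pool `j₀`. -/
noncomputable def closedPsi (hD : D.graph.IsTree) (j₀ : κ) :
    (ι → ℝ) × (κ → ℝ) →ₗ[ℝ] (ι → κ → ℝ) where
  toFun a := D.Psi a.1 (absorb j₀ a)
  map_add' a b := by
    have ha := isFlow_Psi hD.connected (sum_eq_sum_absorb j₀ a)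
    have hb := isFlow_Psi hD.connected (sum_eq_sum_absorb j₀ b)
    rw [map_add]
    exact (ha.add hb).Psi_eq hD.isAcyclic
  map_smul' c a := by
    rw [map_smul]
    exact ((isFlow_Psi hD.connected (sum_eq_sum_absorb j₀ a)).smul c).Psi_eq hD.isAcyclic

lemma isFlow_closedPsi (hD : D.graph.IsTree) (j₀ : κ) (α : ι → ℝ) (β : κ → ℝ) :
    D.IsFlow α (absorb j₀ (α, β)) (closedPsi hD j₀ (α, β)) :=
  isFlow_Psi hD.connected (sum_eq_sum_absorb j₀ (α, β))

lemma closedPsi_eq_Psi (hD : D.graph.IsTree) (j₀ : κ) {α : ι → ℝ} {β : κ → ℝ}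
    (h : ∑ i, α i = ∑ j, β j) : closedPsi hD j₀ (α, β) = D.Psi α β := by
  simp [closedPsi, absorb, h]

lemma closedPsi_single_self (hD : D.graph.IsTree) (j₀ : κ) :
    closedPsi hD j₀ (0, Pi.single j₀ 1) = 0 := by
  have hflow := isFlow_closedPsi hD j₀ 0 (Pi.single j₀ 1)
  have habsorb : absorb j₀ ((0 : ι → ℝ), Pi.single j₀ (1 : ℝ)) = 0 := by
    simp [absorb_apply, ← Pi.single_add]
  exact (habsorb ▸ hflow).eq_zero hD.isAcyclic

end ClosedFlow

section Gain

lemma stepGain_mul_stepGain (hmu : ∀ i j, D.serves i j → D.mu i j ≠ 0) {u v : ι ⊕ κ}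
    (huv : D.graph.Adj u v) : D.stepGain u v * D.stepGain v u = 1 := by
  rcases u with i | j <;> rcases v with i' | j'
  · exact huv.elim
  · exact mul_inv_cancel₀ (hmu _ _ huv)
  · exact inv_mul_cancel₀ (hmu _ _ huv)
  · exact huv.elim

lemma stepGain_pos (hmu : ∀ i j, D.serves i j → 0 < D.mu i j) {u v : ι ⊕ κ}
    (huv : D.graph.Adj u v) : 0 < D.stepGain u v := by
  rcases u with i | j <;> rcases v with i' | j'
  · exact huv.elim
  · exact hmu _ _ huv
  · exact inv_pos.2 (hmu _ _ huv)
  · exact huv.elim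

lemma walkGain_pos (hmu : ∀ i j, D.serves i j → 0 < D.mu i j) {u v : ι ⊕ κ}
    (p : D.graph.Walk u v) : 0 < D.walkGain p := by
  induction p with
  | nil => exact one_pos
  | cons huw _ ih => exact mul_pos (stepGain_pos hmu huw) ih

lemma walkGain_concat {u v w : ι ⊕ κ} (p : D.graph.Walk u v) (hvw : D.graph.Adj v w) :
    D.walkGain (p.concat hvw) = D.walkGain p * D.stepGain v w := by
  induction p with
  | nil => simp [SimpleGraph.Walk.concat, walkGain]
  | cons _ _ ih => simp [SimpleGraph.Walk.concat_cons, walkGain, ih, mul_assoc]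

/-- The gain of the unique path between two vertices of a tree. -/
noncomputable def pathGain (hD : D.graph.IsTree) (u v : ι ⊕ κ) : ℝ :=
  D.walkGain (hD.existsUnique_path u v).choose

lemma pathGain_eq_walkGain (hD : D.graph.IsTree) {u v : ι ⊕ κ} {p : D.graph.Walk u v}
    (hp : p.IsPath) : pathGain hD u v = D.walkGain p :=
  congrArg D.walkGain <|
    (hD.existsUnique_path u v).unique (hD.existsUnique_path u v).choose_spec.1 hp

lemma pathGain_self (hD : D.graph.IsTree) (u : ι ⊕ κ) : pathGain hD u u = 1 :=
  pathGain_eq_walkGain hD .nil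

lemma pathGain_pos (hD : D.graph.IsTree) (hmu : ∀ i j, D.serves i j → 0 < D.mu i j)
    (u v : ι ⊕ κ) : 0 < pathGain hD u v :=
  walkGain_pos hmu _

lemma pathGain_mul_stepGain (hD : D.graph.IsTree) (hmu : ∀ i j, D.serves i j → D.mu i j ≠ 0)
    (u : ι ⊕ κ) {v w : ι ⊕ κ} (hvw : D.graph.Adj v w) :
    pathGain hD u v * D.stepGain v w = pathGain hD u w := by
  obtain ⟨p, hp, -⟩ := hD.existsUnique_path u v
  obtain ⟨q, hq, -⟩ := hD.existsUnique_path u w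
  rw [pathGain_eq_walkGain hD hp, pathGain_eq_walkGain hD hq]
  -- Of two paths from `u` to adjacent endpoints, one extends the other by the edge between them.
  by_cases hv : v ∈ q.support
  · rw [hD.isAcyclic.path_concat hp hq hvw hv, walkGain_concat]
  · have hw := hD.isAcyclic.mem_support_of_ne_mem_support_of_adj_of_isPath hp hq hvw hv
    rw [hD.isAcyclic.path_concat hq hp hvw.symm hw, walkGain_concat, mul_assoc,
      stepGain_mul_stepGain hmu hvw.symm, mul_one]

lemma pathGain_mul_walkGain (hD : D.graph.IsTree) (hmu : ∀ i j, D.serves i j → D.mu i j ≠ 0)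
    (u : ι ⊕ κ) {v w : ι ⊕ κ} (p : D.graph.Walk v w) :
    pathGain hD u v * D.walkGain p = pathGain hD u w := by
  induction p with
  | nil => exact mul_one _
  | cons hvx _ ih => rw [walkGain, ← mul_assoc, pathGain_mul_stepGain hD hmu u hvx, ih]

lemma pathGain_mul_pathGain (hD : D.graph.IsTree) (hmu : ∀ i j, D.serves i j → D.mu i j ≠ 0)
    (u v w : ι ⊕ κ) : pathGain hD u v * pathGain hD v w = pathGain hD u w :=
  pathGain_mul_walkGain hD hmu u _

/-- A potential for the gains: its value at the endpoint of an edge from a class to a pool is its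
value at the class times the gain of the edge. -/
def IsGainPotential (D : NetworkData ι κ) (π : ι ⊕ κ → ℝ) : Prop :=
  ∀ i j, D.serves i j → π (.inl i) * D.mu i j = π (.inr j)

lemma isGainPotential_pathGain (hD : D.graph.IsTree)
    (hmu : ∀ i j, D.serves i j → D.mu i j ≠ 0) (u : ι ⊕ κ) :
    D.IsGainPotential (pathGain hD u) :=
  fun i j hij => pathGain_mul_stepGain hD hmu u (v := .inl i) (w := .inr j) hij

end Gain

section ServiceRate

variable [Fintype κ]

/-- The total rate `∑ j, μ i j z i j` at which each class `i` is served under the allocation `z`. -/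
def serviceRate (D : NetworkData ι κ) : (ι → κ → ℝ) →ₗ[ℝ] (ι → ℝ) where
  toFun z i := ∑ j, D.mu i j * z i j
  map_add' z z' := by ext i; simp [mul_add, Finset.sum_add_distrib]
  map_smul' c z := by ext i; simp [Finset.mul_sum, mul_left_comm]

variable [Fintype ι] {α : ι → ℝ} {β : κ → ℝ} {z : ι → κ → ℝ}

lemma IsFlow.sum_pools_mu_mul (hz : D.IsFlow α β z) (i : ι) :
    ∑ j ∈ D.pools i, D.mu i j * z i j = D.serviceRate z i := by
  refine Finset.sum_subset (Finset.subset_univ _) fun j _ hj => ?_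
  rw [hz.1 i j (by simpa [pools] using hj), mul_zero]

lemma IsFlow.reweight {π : ι ⊕ κ → ℝ} (hπ : D.IsGainPotential π) (hz : D.IsFlow α β z) :
    D.IsFlow (fun i => π (.inl i) * D.serviceRate z i) (fun j => π (.inr j) * β j)
      (fun i j => π (.inl i) * (D.mu i j * z i j)) := by
  have hpool : ∀ i j, π (.inl i) * (D.mu i j * z i j) = π (.inr j) * z i j := fun i j => by
    by_cases hij : D.serves i j
    · rw [← mul_assoc, hπ i j hij]
    · simp [hz.1 i j hij]
  refine ⟨fun i j hij => by simp [hz.1 i j hij], fun i => ?_, fun j => ?_⟩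
  · exact (Finset.mul_sum _ _ _).symm
  · simp only [hpool, ← Finset.mul_sum, hz.2.2]

lemma IsFlow.eq_zero_of_serviceRate_eq_zero (hD : D.graph.IsAcyclic)
    (hmu : ∀ i j, D.serves i j → D.mu i j ≠ 0) {π : ι ⊕ κ → ℝ} (hπ : D.IsGainPotential π)
    (hπ₀ : ∀ i, π (.inl i) ≠ 0) (hz : D.IsFlow α 0 z) (hrate : D.serviceRate z = 0) : z = 0 := by
  have hflow : D.IsFlow 0 0 fun i j => π (.inl i) * (D.mu i j * z i j) := by
    convert hz.reweight hπ <;> simp [hrate]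
  ext i j
  by_cases hij : D.serves i j
  · simpa [hπ₀ i, hmu i j hij] using congrFun₂ (hflow.eq_zero hD) i j
  · exact hz.1 i j hij

end ServiceRate

section DriftMatrices

variable [Fintype ι] [Fintype κ]

/-- The drift of the limiting controlled diffusion with an arbitrary constant term `h`; it is
`ParallelNetwork.drift` for `h = ParallelNetwork.h`. -/
noncomputable def driftWith (D : NetworkData ι κ) (h x uc : ι → ℝ) (us : κ → ℝ) (i : ι) : ℝ :=
  h i - ∑ j ∈ D.pools i,
    D.mu i j * D.Psi (x - max (∑ k, x k) 0 • uc) (-(max (-∑ k, x k) 0 • us)) i j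

/-- `B₁` and `B₂` are the matrices of the drift with constant term `h` relative to the pool `j₀`:
the analogue of `ParallelNetwork.IsDriftMatrices` for `driftWith`. -/
def IsDriftMatricesWith (D : NetworkData ι κ) (h : ι → ℝ) (j₀ : κ) (B₁ : Matrix ι ι ℝ)
    (B₂ : Matrix ι κ ℝ) : Prop :=
  (∀ x : ι → ℝ, ∀ uc ∈ stdSimplex ℝ ι, ∀ us ∈ stdSimplex ℝ κ,
    D.driftWith h x uc us =
      h - B₁ *ᵥ (x - max (∑ k, x k) 0 • uc) + max (-∑ k, x k) 0 • (B₂ *ᵥ us)) ∧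
  ∀ i, B₂ i j₀ = 0

namespace IsDriftMatricesWith

variable {h : ι → ℝ} {j₀ : κ} {B₁ B₁' : Matrix ι ι ℝ} {B₂ B₂' : Matrix ι κ ℝ}

lemma driftWith_neg_single [DecidableEq ι] [DecidableEq κ]
    (hB : D.IsDriftMatricesWith h j₀ B₁ B₂) (i : ι) (j : κ) (k : ι) :
    D.driftWith h (-Pi.single i 1) (Pi.single i 1) (Pi.single j 1) k =
      h k + B₁ k i + B₂ k j := by
  rw [hB.1 _ _ (single_mem_stdSimplex ℝ i) _ (single_mem_stdSimplex ℝ j)]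
  simp [Matrix.mulVec_neg]

lemma unique (hB : D.IsDriftMatricesWith h j₀ B₁ B₂)
    (hB' : D.IsDriftMatricesWith h j₀ B₁' B₂') : B₁ = B₁' ∧ B₂ = B₂' := by
  classical
  have hsum : ∀ i j k, B₁ k i + B₂ k j = B₁' k i + B₂' k j := fun i j k => by
    have hk := (hB.driftWith_neg_single i j k).symm.trans (hB'.driftWith_neg_single i j k)
    linarith
  have hB₁ : B₁ = B₁' := by
    ext k i
    simpa [hB.2 k, hB'.2 k] using hsum i j₀ k
  refine ⟨hB₁, ?_⟩
  ext k j
  simpa [hB₁] using hsum k j k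

end IsDriftMatricesWith

lemma sum_classMarginals_eq_sum_poolMarginals {x uc : ι → ℝ} {us : κ → ℝ} (huc : ∑ i, uc i = 1)
    (hus : ∑ j, us j = 1) :
    ∑ i, (x - max (∑ k, x k) 0 • uc) i = ∑ j, (-(max (-∑ k, x k) 0 • us)) j := by
  simp only [Pi.sub_apply, Pi.neg_apply, Pi.smul_apply, smul_eq_mul, Finset.sum_sub_distrib,
    Finset.sum_neg_distrib, ← Finset.mul_sum, huc, hus, mul_one]
  rcases le_total 0 (∑ k, x k) with hx | hx <;> simp [hx]

variable [DecidableEq κ]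

/-- The matrix `B₁`: the service rates of the flow with class marginals `α` whose pool marginals
are concentrated at `j₀`, as a function of `α`. -/
noncomputable def classMatrix [DecidableEq ι] (hD : D.graph.IsTree) (j₀ : κ) : Matrix ι ι ℝ :=
  (D.serviceRate ∘ₗ closedPsi hD j₀ ∘ₗ LinearMap.inl ℝ (ι → ℝ) (κ → ℝ)).toMatrix'

/-- The matrix `B₂`: the service rates of the flow with zero class marginals whose pool marginals
are `β` away from `j₀`, as a function of `β`. -/
noncomputable def poolMatrix (hD : D.graph.IsTree) (j₀ : κ) : Matrix ι κ ℝ :=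
  (D.serviceRate ∘ₗ closedPsi hD j₀ ∘ₗ LinearMap.inr ℝ (ι → ℝ) (κ → ℝ)).toMatrix'

lemma classMatrix_mulVec [DecidableEq ι] (hD : D.graph.IsTree) (j₀ : κ) (α : ι → ℝ) :
    classMatrix hD j₀ *ᵥ α = D.serviceRate (closedPsi hD j₀ (α, 0)) := by
  rw [classMatrix, LinearMap.toMatrix'_mulVec]
  rfl

lemma poolMatrix_mulVec (hD : D.graph.IsTree) (j₀ : κ) (β : κ → ℝ) :
    poolMatrix hD j₀ *ᵥ β = D.serviceRate (closedPsi hD j₀ (0, β)) := by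
  rw [poolMatrix, LinearMap.toMatrix'_mulVec]
  rfl

lemma poolMatrix_apply_self (hD : D.graph.IsTree) (j₀ : κ) (i : ι) :
    poolMatrix hD j₀ i j₀ = 0 := by
  have hcol := poolMatrix_mulVec hD j₀ (Pi.single j₀ 1)
  rw [closedPsi_single_self, map_zero, Matrix.mulVec_single_one] at hcol
  exact congrFun hcol i

lemma sum_pools_mu_mul_Psi [DecidableEq ι] (hD : D.graph.IsTree) (j₀ : κ) {α : ι → ℝ} {β : κ → ℝ}
    (h : ∑ i, α i = ∑ j, β j) (i : ι) :
    ∑ j ∈ D.pools i, D.mu i j * D.Psi α β i j =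
      (classMatrix hD j₀ *ᵥ α + poolMatrix hD j₀ *ᵥ β) i := by
  rw [(isFlow_Psi hD.connected h).sum_pools_mu_mul, classMatrix_mulVec, poolMatrix_mulVec,
    ← map_add, ← map_add, ← closedPsi_eq_Psi hD j₀ h, Prod.fst_add_snd (α, β)]

lemma isDriftMatricesWith_classMatrix_poolMatrix [DecidableEq ι] (hD : D.graph.IsTree)
    (h : ι → ℝ) (j₀ : κ) :
    D.IsDriftMatricesWith h j₀ (classMatrix hD j₀) (poolMatrix hD j₀) := by
  refine ⟨fun x uc huc us hus => ?_, poolMatrix_apply_self hD j₀⟩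
  ext i
  rw [driftWith, sum_pools_mu_mul_Psi hD j₀ (sum_classMarginals_eq_sum_poolMarginals huc.2 hus.2),
    Matrix.mulVec_neg, Matrix.mulVec_smul]
  simp only [Pi.add_apply, Pi.sub_apply, Pi.neg_apply]
  ring

section Potential

variable [DecidableEq ι] {π : ι ⊕ κ → ℝ}

lemma IsGainPotential.dotProduct_classMatrix_mulVec (hπ : D.IsGainPotential π)
    (hD : D.graph.IsTree) (j₀ : κ) (α : ι → ℝ) :
    (π ∘ .inl) ⬝ᵥ (classMatrix hD j₀ *ᵥ α) = π (.inr j₀) * ∑ i, α i := by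
  rw [classMatrix_mulVec]
  refine ((isFlow_closedPsi hD j₀ α 0).reweight hπ).sum_eq.trans ?_
  simp [absorb_apply, Pi.single_apply]

lemma IsGainPotential.vecMul_classMatrix (hπ : D.IsGainPotential π) (hD : D.graph.IsTree)
    (j₀ : κ) :
    (π ∘ .inl) ᵥ* classMatrix hD j₀ = fun _ => π (.inr j₀) := by
  ext i
  have hi := hπ.dotProduct_classMatrix_mulVec hD j₀ (Pi.single i 1)
  simpa only [Matrix.dotProduct_mulVec, dotProduct_single_one, Fintype.sum_pi_single',
    mul_one] using hi

lemma IsGainPotential.isUnit_classMatrix (hπ : D.IsGainPotential π) (hD : D.graph.IsTree)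
    (hmu : ∀ i j, D.serves i j → D.mu i j ≠ 0) (hπ₀ : ∀ v, π v ≠ 0) (j₀ : κ) :
    IsUnit (classMatrix hD j₀) := by
  rw [← Matrix.mulVec_injective_iff_isUnit]
  refine (injective_iff_map_eq_zero (classMatrix hD j₀).mulVecLin).2 fun α hα => ?_
  rw [Matrix.mulVecLin_apply] at hα
  have hsum : ∑ i, α i = 0 := by
    simpa [hα, hπ₀] using hπ.dotProduct_classMatrix_mulVec hD j₀ α
  have hflow := isFlow_closedPsi hD j₀ α 0
  have hzero : closedPsi hD j₀ (α, 0) = 0 := by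
    refine IsFlow.eq_zero_of_serviceRate_eq_zero hD.isAcyclic hmu hπ (fun i => hπ₀ _)
      (α := α) ?_ (classMatrix_mulVec hD j₀ α ▸ hα)
    simpa [absorb_apply, hsum] using hflow
  ext i
  simp [← hflow.2.1 i, hzero]

end Potential

end DriftMatrices

end NetworkData

open NetworkData in
theorem theorem3_general {ι κ : Type*} [Fintype ι] [Fintype κ] [DecidableEq ι]
    {D : NetworkData ι κ} (hD : D.graph.IsTree) (hmu : ∀ i j, D.serves i j → 0 < D.mu i j)
    (h : ι → ℝ) (j₀ : κ) :
    (∃! B : Matrix ι ι ℝ × Matrix ι κ ℝ, D.IsDriftMatricesWith h j₀ B.1 B.2) ∧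
    ∀ (B₁ : Matrix ι ι ℝ) (B₂ : Matrix ι κ ℝ), D.IsDriftMatricesWith h j₀ B₁ B₂ →
      IsUnit B₁.det ∧
      (∀ i l : ι, pathGain hD (.inl i) (.inl l) =
        ((1 : ι → ℝ) ᵥ* B₁⁻¹) l / ((1 : ι → ℝ) ᵥ* B₁⁻¹) i) ∧
      ∀ i : ι, 0 < ((1 : ι → ℝ) ᵥ* B₁⁻¹) i := by
  classical
  have hmu₀ : ∀ i j, D.serves i j → D.mu i j ≠ 0 := fun i j hij => (hmu i j hij).ne'
  have hB := isDriftMatricesWith_classMatrix_poolMatrix hD h j₀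
  refine ⟨⟨(_, _), hB, fun B hB' => Prod.ext_iff.2 (hB'.unique hB)⟩, fun B₁ B₂ hB' => ?_⟩
  obtain ⟨rfl, rfl⟩ := hB'.unique hB
  let π : ι ⊕ κ → ℝ := pathGain hD (.inr j₀)
  have hπ : D.IsGainPotential π := isGainPotential_pathGain hD hmu₀ _
  have hpos : ∀ v, 0 < π v := pathGain_pos hD hmu _
  have hunit : IsUnit (classMatrix hD j₀).det := (Matrix.isUnit_iff_isUnit_det _).1 <|
    hπ.isUnit_classMatrix hD hmu₀ (fun v => (hpos v).ne') j₀
  have hone : (1 : ι → ℝ) ᵥ* (classMatrix hD j₀)⁻¹ = π ∘ .inl := by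
    have hvec : (π ∘ .inl) ᵥ* classMatrix hD j₀ = 1 :=
      (hπ.vecMul_classMatrix hD j₀).trans (funext fun _ => pathGain_self hD _)
    rw [← hvec, Matrix.vecMul_vecMul, Matrix.mul_nonsing_inv _ hunit, Matrix.vecMul_one]
  refine ⟨hunit, fun i l => ?_, fun i => ?_⟩
  · rw [hone]
    exact eq_div_of_mul_eq (hpos _).ne' <|
      (mul_comm _ _).trans (pathGain_mul_pathGain hD hmu₀ _ (.inl i) _)
  · exact hone ▸ hpos (.inl i)

theorem theorem3 {ι κ : Type*} [Fintype ι] [Fintype κ] [DecidableEq ι]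
    (N : ParallelNetwork ι κ) (j₀ : κ) :
    (∃! B : Matrix ι ι ℝ × Matrix ι κ ℝ, N.IsDriftMatrices j₀ B.1 B.2) ∧
    ∀ (B₁ : Matrix ι ι ℝ) (B₂ : Matrix ι κ ℝ), N.IsDriftMatrices j₀ B₁ B₂ →
      IsUnit B₁.det ∧
      (∀ i l : ι, N.gain i l = ((1 : ι → ℝ) ᵥ* B₁⁻¹) l / ((1 : ι → ℝ) ᵥ* B₁⁻¹) i) ∧
      ∀ i : ι, 0 < ((1 : ι → ℝ) ᵥ* B₁⁻¹) i :=
  theorem3_general N.isTree N.mu_pos N.h j₀
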